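/- Let $k\ge 1$ and $\mathbb I=[0,1]$. A $k$-dimensional copula is the restriction to $\mathbb I^k$ of the joint distribution function of a random vector whose $k$ components are each uniformly distributed on $\mathbb I$. For a copula $C$ define the fractional cumulative copula entropy (FCCE) and the cumulative copula information generating function (CCIGF) by $$\zeta_r(C)=\int_{\mathbb I^k} C(\mathbf u)\bigl(-\ln C(\mathbf u)\bigr)^r\,d\mathbf u\quad(0\le r\le 1),\qquad \mathcal G_C(s)=\int_{\mathbb I^k} C(\mathbf u)^s\,d\mathbf u\quad(s>0),$$ where the first integrand is taken to be $0$ at points with $C(\mathbf u)=0$, and to be $C(\mathbf u)$ if $r=0$. Let $\mathbf X_1,\mathbf X_2,\dots$ be independent, identically distributed random vectors in $\mathbb R^k$, $\mathbf X_i=(X_{i,1},\dots,X_{i,k})$, whose common joint distribution function $\mathbf F$ has continuous marginal distribution functions $F_1,\dots,F_k$, and let $C$ be the underlying copula, that is, the copula with $\mathbf F(x_1,\dots,x_k)=C(F_1(x_1),\dots,F_k(x_k))$ for all $\mathbf x\in\mathbb R^k$. For $N\ge1$ and $1\le i\le N$ let $R_{i,j}=\#\{l\le N: X_{l,j}\le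 X_{i,j}\}$ be the rank of $X_{i,j}$ among $X_{1,j},\dots,X_{N,j}$, and let $$\hat C_N(\mathbf u)=\frac1N\sum_{i=1}^N\prod_{j=1}^k\sum_{y=R_{i,j}}^N\binom Ny u_j^y(1-u_j)^{N-y},\qquad \mathbf u\in\mathbb I^k,$$ be the empirical beta copula. Define the fractional empirical beta cumulative copula entropy $\zeta_r(\hat C_N)$ and the empirical beta CCIGF $\mathcal G_{\hat C_N}(s)$ by the above formulas with $\hat C_N$ in place of $C$. Then: (a) for every $r\in[0,1]$, $\zeta_r(\hat C_N)\to\zeta_r(C)$ almost surely as $N\to\infty$; (b) for every $s>0$, $\mathcal G_{\hat C_N}(s)\to\mathcal G_C(s)$ almost surely as $N\to\infty$. -/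

import Mathlib

open MeasureTheory ProbabilityTheory

noncomputable section

/-- A `k`-dimensional copula: the restriction to `[0,1]^k` of the joint distribution function of a
random vector all of whose components are uniformly distributed on `[0,1]`. Only the values of `C`
on `[0,1]^k` are relevant. -/
def IsCopula {k : ℕ} (C : (Fin k → ℝ) → ℝ) : Prop :=
  ∃ ν : Measure (Fin k → ℝ), IsProbabilityMeasure ν ∧
    (∀ j, ν.map (fun u => u j) = volume.restrict (Set.Icc (0 : ℝ) 1)) ∧
    ∀ u ∈ Set.Icc (0 : Fin k → ℝ) 1, C u = ν.real (Set.Iic u)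

/-- The joint distribution function `F(x) = μ(X₁ ≤ x₁, …, X_k ≤ x_k)` of a law on `ℝ^k`. -/
def jointCDF {k : ℕ} (μ : Measure (Fin k → ℝ)) (x : Fin k → ℝ) : ℝ :=
  μ.real (Set.Iic x)

/-- The `j`-th marginal distribution function `F_j` of a law on `ℝ^k`. -/
def marginalCDF {k : ℕ} (μ : Measure (Fin k → ℝ)) (j : Fin k) (t : ℝ) : ℝ :=
  cdf (μ.map (fun x => x j)) t

/-- A continuous `k`-variate distribution: all marginal distribution functions are continuous
(equivalently, the joint distribution function is continuous). -/
def IsContinuousLaw {k : ℕ} (μ : Measure (Fin k → ℝ)) : Prop :=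
  ∀ j, Continuous (marginalCDF μ j)

/-- `C` is a copula underlying the law `μ`: `F(x) = C(F₁(x₁), …, F_k(x_k))` for all `x`. -/
def IsCopulaOf {k : ℕ} (C : (Fin k → ℝ) → ℝ) (μ : Measure (Fin k → ℝ)) : Prop :=
  IsCopula C ∧ ∀ x : Fin k → ℝ, jointCDF μ x = C (fun j => marginalCDF μ j (x j))

/-- The rank, in `{1, …, N}`, of the `j`-th coordinate of the `i`-th observation among the `j`-th
coordinates of all `N` observations. -/
def sampleRank {k N : ℕ} (x : Fin N → Fin k → ℝ) (i : Fin N) (j : Fin k) : ℕ :=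
  (Finset.univ.filter (fun l : Fin N => x l j ≤ x i j)).card

/-- The empirical beta copula of the sample `x` of size `N`. -/
def empiricalBetaCopula {k N : ℕ} (x : Fin N → Fin k → ℝ) (u : Fin k → ℝ) : ℝ :=
  (1 / (N : ℝ)) * ∑ i : Fin N, ∏ j : Fin k, ∑ y ∈ Finset.Icc (sampleRank x i j) N,
    (N.choose y : ℝ) * u j ^ y * (1 - u j) ^ (N - y)

/-- The fractional cumulative copula entropy `ζ_r(C) = ∫_{[0,1]^k} C(u) (-ln C(u))^r du`. -/
def fracCCE {k : ℕ} (r : ℝ) (C : (Fin k → ℝ) → ℝ) : ℝ :=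
  ∫ u in Set.Icc (0 : Fin k → ℝ) 1, C u * (-Real.log (C u)) ^ r

/-- The cumulative copula information generating function `G_C(s) = ∫_{[0,1]^k} C(u)^s du`. -/
def CCIGF {k : ℕ} (C : (Fin k → ℝ) → ℝ) (s : ℝ) : ℝ :=
  ∫ u in Set.Icc (0 : Fin k → ℝ) 1, C u ^ s

end

open Filter Topology

noncomputable section

/-! The factors of the empirical beta copula are binomial tails `P(Bin(N, u_j) ≥ R_ij)`. By
Chebyshev such a tail is near 1 when `R_ij / N` stays below `u_j` and near 0 when it stays above. So
for `u` in the open cube the estimator is squeezed, up to `O(1/N)`, between empirical frequencies of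
two quadrants whose corners have marginal levels slightly below and slightly above `u`
(`le_empiricalBetaCopula`, `empiricalBetaCopula_le`). The strong law sends these frequencies to
values of `C` near `u`, and the Lipschitz property `IsCopula.sub_le` closes the gap.

Since `x * (-log x) ^ r` and `x ^ s` are continuous, hence bounded, on `[0,1]`, dominated
convergence then passes to the integrals; pointwise convergence is enough. -/

/-- The upper tail `P(S ≥ R)` of a binomial variable `S` with parameters `N` and `p`. -/
def binomialTail (N R : ℕ) (p : ℝ) : ℝ :=
  ∑ y ∈ Finset.Icc R N, (N.choose y : ℝ) * p ^ y * (1 - p) ^ (N - y)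

/-- The proportion of the points of the sample `x` that lie in `S`. -/
def sampleFreq {E : Type*} {N : ℕ} (x : Fin N → E) (S : Set E) : ℝ :=
  (∑ i, S.indicator (fun _ => (1 : ℝ)) (x i)) / N

theorem empiricalBetaCopula_eq {k N : ℕ} (x : Fin N → Fin k → ℝ) (u : Fin k → ℝ) :
    empiricalBetaCopula x u =
      (∑ i, ∏ j, binomialTail N (sampleRank x i j) (u j)) / N := by
  simp only [empiricalBetaCopula, binomialTail]
  ring

/-! ### Chebyshev bounds for binomial tails -/

section BinomialTail

variable {N : ℕ} {p : ℝ}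

theorem binomial_weight_nonneg (h0 : 0 ≤ p) (h1 : p ≤ 1) (y : ℕ) :
    0 ≤ (N.choose y : ℝ) * p ^ y * (1 - p) ^ (N - y) := by
  have : 0 ≤ 1 - p := sub_nonneg.2 h1
  positivity

theorem sum_binomial_weight (N : ℕ) (p : ℝ) :
    ∑ y ∈ Finset.range (N + 1), (N.choose y : ℝ) * p ^ y * (1 - p) ^ (N - y) = 1 := by
  have h := congrArg (Polynomial.eval p) (bernsteinPolynomial.sum ℝ N)
  simpa [Polynomial.eval_finsetSum, bernsteinPolynomial] using h

theorem sum_sq_mul_binomial_weight (N : ℕ) (p : ℝ) :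
    ∑ y ∈ Finset.range (N + 1),
      (N * p - y) ^ 2 * ((N.choose y : ℝ) * p ^ y * (1 - p) ^ (N - y)) = N * p * (1 - p) := by
  have h := congrArg (Polynomial.eval p) (bernsteinPolynomial.variance ℝ N)
  simpa [Polynomial.eval_finsetSum, bernsteinPolynomial] using h

theorem Icc_subset_range_succ (R N : ℕ) : Finset.Icc R N ⊆ Finset.range (N + 1) := by
  intro y hy
  simp only [Finset.mem_Icc, Finset.mem_range] at *
  omega

theorem binomialTail_nonneg (R : ℕ) (h0 : 0 ≤ p) (h1 : p ≤ 1) : 0 ≤ binomialTail N R p :=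
  Finset.sum_nonneg fun y _ => binomial_weight_nonneg h0 h1 y

theorem binomialTail_le_one (R : ℕ) (h0 : 0 ≤ p) (h1 : p ≤ 1) : binomialTail N R p ≤ 1 := by
  rw [← sum_binomial_weight N p]
  exact Finset.sum_le_sum_of_subset_of_nonneg (Icc_subset_range_succ R N)
    fun y _ _ => binomial_weight_nonneg h0 h1 y

/-- Chebyshev's inequality for the binomial distribution. -/
theorem sum_binomial_weight_le (hN : 0 < N) (h0 : 0 ≤ p) (h1 : p ≤ 1) {c : ℝ} (hc : c ≠ p)
    {A : Finset ℕ} (hA : A ⊆ Finset.range (N + 1))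
    (hdev : ∀ y ∈ A, (N * (p - c)) ^ 2 ≤ (N * p - y) ^ 2) :
    ∑ y ∈ A, (N.choose y : ℝ) * p ^ y * (1 - p) ^ (N - y) ≤ 1 / (N * (p - c) ^ 2) := by
  have hN' : (0 : ℝ) < N := by exact_mod_cast hN
  have hpc : 0 < (p - c) ^ 2 := by
    have := sub_ne_zero.2 hc.symm
    positivity
  have key : (N * (p - c)) ^ 2 * ∑ y ∈ A, (N.choose y : ℝ) * p ^ y * (1 - p) ^ (N - y) ≤ N := by
    calc _ ≤ ∑ y ∈ A, (N * p - y) ^ 2 * ((N.choose y : ℝ) * p ^ y * (1 - p) ^ (N - y)) := by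
          rw [Finset.mul_sum]
          exact Finset.sum_le_sum fun y hy =>
            mul_le_mul_of_nonneg_right (hdev y hy) (binomial_weight_nonneg h0 h1 y)
      _ ≤ N * p * (1 - p) := by
          rw [← sum_sq_mul_binomial_weight]
          exact Finset.sum_le_sum_of_subset_of_nonneg hA
            fun y _ _ => mul_nonneg (sq_nonneg _) (binomial_weight_nonneg h0 h1 y)
      _ ≤ N := by
          have : p * (1 - p) ≤ 1 := by nlinarith
          nlinarith
  rw [le_div_iff₀ (by positivity)]
  refine le_of_mul_le_mul_left ?_ hN'
  linarith [key]

theorem binomialTail_le {R : ℕ} {c : ℝ} (hN : 0 < N) (h0 : 0 ≤ p) (h1 : p ≤ 1)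
    (hc : p < c) (hR : N * c ≤ R) : binomialTail N R p ≤ 1 / (N * (p - c) ^ 2) := by
  refine sum_binomial_weight_le hN h0 h1 hc.ne' (Icc_subset_range_succ R N) fun y hy => ?_
  have hy' : (R : ℝ) ≤ y := by exact_mod_cast (Finset.mem_Icc.1 hy).1
  have : 0 ≤ (N : ℝ) * (c - p) := mul_nonneg N.cast_nonneg (sub_nonneg.2 hc.le)
  rw [sq_le_sq]
  rw [abs_of_nonpos (by linarith), abs_of_nonpos (by linarith)]
  linarith

/-- The missing mass sits on `y < R ≤ N c`, at distance at least `N (p - c)` from the mean. -/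
theorem le_binomialTail {R : ℕ} {c : ℝ} (hN : 0 < N) (h0 : 0 ≤ p) (h1 : p ≤ 1)
    (hc : c < p) (hR : R ≤ N * c) : 1 - 1 / (N * (p - c) ^ 2) ≤ binomialTail N R p := by
  have hsub := Icc_subset_range_succ R N
  have hsplit := Finset.sum_sdiff (f := fun y : ℕ =>
    (N.choose y : ℝ) * p ^ y * (1 - p) ^ (N - y)) hsub
  rw [sum_binomial_weight] at hsplit
  have := sum_binomial_weight_le hN h0 h1 hc.ne
    (A := Finset.range (N + 1) \ Finset.Icc R N) Finset.sdiff_subset fun y hy => by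
      have hy' : (y : ℝ) ≤ R := by
        simp only [Finset.mem_sdiff, Finset.mem_range, Finset.mem_Icc] at hy
        exact_mod_cast (by omega : y ≤ R)
      have : 0 ≤ (N : ℝ) * (p - c) := mul_nonneg N.cast_nonneg (sub_nonneg.2 hc.le)
      rw [sq_le_sq, abs_of_nonneg this, abs_of_nonneg (by linarith)]
      linarith
  unfold binomialTail
  linarith

end BinomialTail

/-! ### Squeezing the estimator between quadrant frequencies -/

section Deterministic

variable {k N : ℕ}

theorem empiricalBetaCopula_mem_Icc (x : Fin N → Fin k → ℝ) {u : Fin k → ℝ}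
    (hu : u ∈ Set.Icc (0 : Fin k → ℝ) 1) : empiricalBetaCopula x u ∈ Set.Icc (0 : ℝ) 1 := by
  rw [empiricalBetaCopula_eq]
  have h0 : ∀ i j, 0 ≤ binomialTail N (sampleRank x i j) (u j) := fun i j =>
    binomialTail_nonneg _ (hu.1 j) (hu.2 j)
  -- `div_le_one_of_le₀` also covers `N = 0`, where the quotient is `0 / 0 = 0`.
  refine ⟨div_nonneg (Finset.sum_nonneg fun i _ => Finset.prod_nonneg fun j _ => h0 i j)
    N.cast_nonneg, div_le_one_of_le₀ ?_ N.cast_nonneg⟩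
  calc _ ≤ ∑ _i : Fin N, (1 : ℝ) := Finset.sum_le_sum fun i _ =>
        Finset.prod_le_one (fun j _ => h0 i j) fun j _ => binomialTail_le_one _ (hu.1 j) (hu.2 j)
    _ = N := by simp

theorem continuous_empiricalBetaCopula (x : Fin N → Fin k → ℝ) :
    Continuous (empiricalBetaCopula x) := by
  unfold empiricalBetaCopula
  fun_prop

theorem card_filter_eq_sampleFreq (hN : 0 < N) (x : Fin N → Fin k → ℝ) (j : Fin k) (t : ℝ) :
    ((Finset.univ.filter fun l => x l j ≤ t).card : ℝ) = N * sampleFreq x {z | z j ≤ t} := by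
  have : (N : ℝ) ≠ 0 := by positivity
  rw [sampleFreq, mul_div_cancel₀ _ this]
  simp [Set.indicator_apply, Finset.sum_boole]

/-- A sample point in the quadrant has `j`-th rank at most `N * c j`, below the mean `N * u j`, so
all its factors are near 1; the other points contribute nonnegatively. The `max 0` lets the
factorwise bounds be multiplied. -/
theorem le_empiricalBetaCopula (hN : 0 < N) (x : Fin N → Fin k → ℝ) {u : Fin k → ℝ}
    (hu : u ∈ Set.Icc (0 : Fin k → ℝ) 1) {t c : Fin k → ℝ} (hc : ∀ j, c j < u j)
    (ht : ∀ j, sampleFreq x {z | z j ≤ t j} ≤ c j) :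
    sampleFreq x (Set.Iic t) * ∏ j, max 0 (1 - 1 / (N * (u j - c j) ^ 2)) ≤
      empiricalBetaCopula x u := by
  rw [empiricalBetaCopula_eq, sampleFreq, div_mul_eq_mul_div, Finset.sum_mul]
  gcongr with i
  by_cases hi : x i ∈ Set.Iic t
  · rw [Set.indicator_of_mem hi, one_mul]
    refine Finset.prod_le_prod (fun j _ => le_max_left _ _) fun j _ =>
      max_le (binomialTail_nonneg _ (hu.1 j) (hu.2 j))
        (le_binomialTail hN (hu.1 j) (hu.2 j) (hc j) ?_)
    calc (sampleRank x i j : ℝ) ≤ (Finset.univ.filter fun l => x l j ≤ t j).card := by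
          exact_mod_cast Finset.card_le_card fun l hl => by
            simp only [Finset.mem_filter, Finset.mem_univ, true_and] at hl ⊢
            exact hl.trans (hi j)
      _ = N * sampleFreq x {z | z j ≤ t j} := card_filter_eq_sampleFreq hN x j (t j)
      _ ≤ N * c j := by gcongr; exact ht j
  · rw [Set.indicator_of_notMem hi, zero_mul]
    exact Finset.prod_nonneg fun j _ => binomialTail_nonneg _ (hu.1 j) (hu.2 j)

/-- A sample point outside the quadrant exceeds `t` in some coordinate; its rank there is at least
`N * c j`, so that single factor makes the product small. Summing over `j` avoids tracking which
coordinate it is. -/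
theorem empiricalBetaCopula_le (hN : 0 < N) (x : Fin N → Fin k → ℝ) {u : Fin k → ℝ}
    (hu : u ∈ Set.Icc (0 : Fin k → ℝ) 1) {t c : Fin k → ℝ} (hc : ∀ j, u j < c j)
    (ht : ∀ j, c j ≤ sampleFreq x {z | z j ≤ t j}) :
    empiricalBetaCopula x u ≤
      sampleFreq x (Set.Iic t) + ∑ j, 1 / (N * (u j - c j) ^ 2) := by
  have hN' : (0 : ℝ) < N := by exact_mod_cast hN
  set d := ∑ j, 1 / ((N : ℝ) * (u j - c j) ^ 2) with hd
  have hd0 : ∀ j, 0 ≤ 1 / ((N : ℝ) * (u j - c j) ^ 2) := fun j => by positivity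
  have h0 : ∀ i j, 0 ≤ binomialTail N (sampleRank x i j) (u j) := fun i j =>
    binomialTail_nonneg _ (hu.1 j) (hu.2 j)
  have h1 : ∀ i j, binomialTail N (sampleRank x i j) (u j) ≤ 1 := fun i j =>
    binomialTail_le_one _ (hu.1 j) (hu.2 j)
  have hterm : ∀ i, ∏ j, binomialTail N (sampleRank x i j) (u j) ≤
      (Set.Iic t).indicator (fun _ => (1 : ℝ)) (x i) + d := fun i => by
    by_cases hi : x i ∈ Set.Iic t
    · rw [Set.indicator_of_mem hi]
      have := Finset.prod_le_one (s := Finset.univ) (fun j _ => h0 i j) (fun j _ => h1 i j)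
      have : 0 ≤ d := Finset.sum_nonneg fun j _ => hd0 j
      linarith
    · rw [Set.indicator_of_notMem hi, zero_add]
      obtain ⟨j, hj⟩ : ∃ j, t j < x i j := by
        simpa [Pi.le_def] using hi
      calc ∏ j, binomialTail N (sampleRank x i j) (u j)
          ≤ binomialTail N (sampleRank x i j) (u j) := by
            rw [← Finset.mul_prod_erase _ _ (Finset.mem_univ j)]
            exact mul_le_of_le_one_right (h0 i j)
              (Finset.prod_le_one (fun j _ => h0 i j) fun j _ => h1 i j)
        _ ≤ 1 / (N * (u j - c j) ^ 2) := by
            refine binomialTail_le hN (hu.1 j) (hu.2 j) (hc j) ?_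
            calc N * c j ≤ N * sampleFreq x {z | z j ≤ t j} := by gcongr; exact ht j
              _ = (Finset.univ.filter fun l => x l j ≤ t j).card :=
                (card_filter_eq_sampleFreq hN x j (t j)).symm
              _ ≤ sampleRank x i j := by
                exact_mod_cast Finset.card_le_card fun l hl => by
                  simp only [Finset.mem_filter, Finset.mem_univ, true_and] at hl ⊢
                  exact hl.trans hj.le
        _ ≤ d := Finset.single_le_sum (f := fun j => 1 / ((N : ℝ) * (u j - c j) ^ 2))
            (fun j _ => hd0 j) (Finset.mem_univ j)
  rw [empiricalBetaCopula_eq, sampleFreq, div_add' _ _ _ hN'.ne']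
  gcongr
  calc _ ≤ ∑ i, ((Set.Iic t).indicator (fun _ => (1 : ℝ)) (x i) + d) :=
        Finset.sum_le_sum fun i _ => hterm i
    _ = _ := by simp [Finset.sum_add_distrib, mul_comm]

end Deterministic

/-- The strong law of large numbers for empirical frequencies. -/
theorem ae_tendsto_sampleFreq {E Ω : Type*} [MeasurableSpace E] [MeasurableSpace Ω]
    {P : Measure Ω} [IsProbabilityMeasure P] {μ : Measure E} [IsProbabilityMeasure μ]
    {X : ℕ → Ω → E} (hlaw : ∀ i, HasLaw (X i) μ P) (hindep : iIndepFun X P)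
    {S : Set E} (hS : MeasurableSet S) :
    ∀ᵐ ω ∂P, Tendsto (fun N : ℕ => sampleFreq (fun i : Fin N => X i ω) S) atTop
      (𝓝 (μ.real S)) := by
  have hg : Measurable (S.indicator fun _ : E => (1 : ℝ)) := measurable_const.indicator hS
  have hint : Integrable (S.indicator fun _ : E => (1 : ℝ)) μ :=
    (integrable_const 1).indicator hS
  have hid : ∀ i, IdentDistrib (X i) (X 0) P P := fun i =>
    ⟨(hlaw i).aemeasurable, (hlaw 0).aemeasurable, by rw [(hlaw i).map_eq, (hlaw 0).map_eq]⟩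
  have hslln := strong_law_ae_real (μ := P) (fun i => (S.indicator fun _ => (1 : ℝ)) ∘ X i)
    (by
      have := hint
      rw [← (hlaw 0).map_eq] at this
      exact this.comp_aemeasurable (hlaw 0).aemeasurable)
    (fun i j hij => (hindep.indepFun hij).comp hg hg)
    (fun i => (hid i).comp hg)
  have hmean : ∫ ω, ((S.indicator fun _ => (1 : ℝ)) ∘ X 0) ω ∂P = μ.real S := by
    have := integral_map (hlaw 0).aemeasurable (f := S.indicator fun _ : E => (1 : ℝ))
      hg.aestronglyMeasurable
    rw [(hlaw 0).map_eq] at this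
    simp only [Function.comp_apply]
    rw [← this, integral_indicator hS]
    simp
  rw [hmean] at hslln
  filter_upwards [hslln] with ω hω
  refine hω.congr fun N => ?_
  rw [sampleFreq, Finset.sum_range]
  rfl

/-! ### Bounds and Lipschitz continuity of copulas -/

section Copula

variable {k : ℕ} {C : (Fin k → ℝ) → ℝ}

theorem IsCopula.mem_Icc (hC : IsCopula C) {u : Fin k → ℝ}
    (hu : u ∈ Set.Icc (0 : Fin k → ℝ) 1) : C u ∈ Set.Icc (0 : ℝ) 1 := by
  obtain ⟨ν, hν, -, hCν⟩ := hC
  rw [hCν u hu]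
  exact ⟨measureReal_nonneg, measureReal_le_one⟩

/-- A copula is `1`-Lipschitz for the `ℓ¹` distance; this is the version for comparable points. -/
theorem IsCopula.sub_le (hC : IsCopula C) {u v : Fin k → ℝ}
    (hu : u ∈ Set.Icc (0 : Fin k → ℝ) 1) (hv : v ∈ Set.Icc (0 : Fin k → ℝ) 1) (hvu : v ≤ u) :
    C u - C v ≤ ∑ j, (u j - v j) := by
  obtain ⟨ν, hν, hmarg, hCν⟩ := hC
  rw [hCν u hu, hCν v hv]
  -- Uniform marginals give each coordinate strip a mass equal to its width.
  have hstrip : ∀ j, ν.real {z | z j ∈ Set.Ioc (v j) (u j)} = u j - v j := fun j => by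
    have h : ν.map (fun z => z j) (Set.Ioc (v j) (u j)) = ν {z | z j ∈ Set.Ioc (v j) (u j)} :=
      Measure.map_apply (measurable_pi_apply j) measurableSet_Ioc
    have hsub : Set.Ioc (v j) (u j) ⊆ Set.Icc 0 1 := fun z hz =>
      ⟨(hv.1 j).trans hz.1.le, hz.2.trans (hu.2 j)⟩
    rw [measureReal_def, ← h, hmarg j, Measure.restrict_apply measurableSet_Ioc,
      Set.inter_eq_left.2 hsub,
      Real.volume_Ioc, ENNReal.toReal_ofReal (sub_nonneg.2 (hvu j))]
  have hcover : Set.Iic u ⊆ Set.Iic v ∪ ⋃ j, {z | z j ∈ Set.Ioc (v j) (u j)} := by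
    intro z hz
    by_cases hzv : z ≤ v
    · exact Or.inl hzv
    · obtain ⟨j, hj⟩ : ∃ j, v j < z j := by simpa [Pi.le_def] using hzv
      exact Or.inr (Set.mem_iUnion.2 ⟨j, hj, hz j⟩)
  calc ν.real (Set.Iic u) - ν.real (Set.Iic v)
      ≤ ν.real (⋃ j, {z | z j ∈ Set.Ioc (v j) (u j)}) := by
        linarith [measureReal_mono (μ := ν) hcover, measureReal_union_le (μ := ν) (Set.Iic v)
          (⋃ j, {z : Fin k → ℝ | z j ∈ Set.Ioc (v j) (u j)})]
    _ ≤ ∑ j, ν.real {z | z j ∈ Set.Ioc (v j) (u j)} := measureReal_iUnion_fintype_le _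
    _ = ∑ j, (u j - v j) := Finset.sum_congr rfl fun j _ => hstrip j

end Copula

/-! ### Marginal distribution functions -/

section Marginals

variable {k : ℕ} {μ : Measure (Fin k → ℝ)} [IsProbabilityMeasure μ]

theorem marginalCDF_eq_real (j : Fin k) (t : ℝ) :
    marginalCDF μ j t = μ.real {z | z j ≤ t} := by
  have := Measure.isProbabilityMeasure_map (μ := μ) (measurable_pi_apply j).aemeasurable
  rw [marginalCDF, cdf_eq_real, measureReal_def,
    Measure.map_apply (measurable_pi_apply j) measurableSet_Iic]
  rfl

theorem marginalCDF_mem_Icc (t : Fin k → ℝ) :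
    (fun j => marginalCDF μ j (t j)) ∈ Set.Icc (0 : Fin k → ℝ) 1 := by
  refine ⟨fun j => ?_, fun j => ?_⟩ <;> simp only [marginalCDF_eq_real]
  exacts [measureReal_nonneg, measureReal_le_one]

/-- The intermediate value theorem attains the midpoint of `(a, b)`; continuity and density then
allow a rational argument. -/
theorem exists_rat_marginalCDF_mem_Ioo (hμ : IsContinuousLaw μ) (j : Fin k) {a b : ℝ}
    (ha : 0 ≤ a) (hab : a < b) (hb : b ≤ 1) : ∃ q : ℚ, marginalCDF μ j q ∈ Set.Ioo a b := by
  have := Measure.isProbabilityMeasure_map (μ := μ) (measurable_pi_apply j).aemeasurable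
  have hbot : Tendsto (marginalCDF μ j) atBot (𝓝 0) := tendsto_cdf_atBot _
  have htop : Tendsto (marginalCDF μ j) atTop (𝓝 1) := tendsto_cdf_atTop _
  obtain ⟨s, hs⟩ := (hbot.eventually_lt_const (by linarith : 0 < (a + b) / 2)).exists
  obtain ⟨t, ht⟩ := (htop.eventually_const_lt (by linarith : (a + b) / 2 < 1)).exists
  obtain ⟨z, hz⟩ := mem_range_of_exists_le_of_exists_ge (hμ j) ⟨s, hs.le⟩ ⟨t, ht.le⟩
  exact (Rat.isDenseEmbedding_coe_real.dense).exists_mem_open (isOpen_Ioo.preimage (hμ j))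
    ⟨z, by simp only [Set.mem_preimage, hz]; constructor <;> linarith⟩

end Marginals

theorem tendsto_one_div_natCast_mul (a : ℝ) :
    Tendsto (fun N : ℕ => 1 / ((N : ℝ) * a)) atTop (𝓝 0) := by
  have := (tendsto_one_div_atTop_nhds_zero_nat (𝕜 := ℝ)).mul_const (1 / a)
  simpa [one_div, mul_comm] using this

/-! ### Almost sure pointwise convergence -/

section Pointwise

variable {k : ℕ} {μ : Measure (Fin k → ℝ)} [IsProbabilityMeasure μ] {C : (Fin k → ℝ) → ℝ}

/-- If the empirical frequencies of the quadrants and half-spaces with rational corners converge,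
then the empirical beta copulas converge on the open unit cube. -/
theorem tendsto_empiricalBetaCopula (hμ : IsContinuousLaw μ) (hC : IsCopulaOf C μ)
    {x : ℕ → Fin k → ℝ}
    (hjoint : ∀ q : Fin k → ℚ, Tendsto (fun N : ℕ => sampleFreq (fun i : Fin N => x i)
      (Set.Iic fun j => (q j : ℝ))) atTop (𝓝 (μ.real (Set.Iic fun j => (q j : ℝ)))))
    (hmarg : ∀ (j : Fin k) (q : ℚ), Tendsto (fun N : ℕ => sampleFreq (fun i : Fin N => x i)
      {z | z j ≤ (q : ℝ)}) atTop (𝓝 (μ.real {z | z j ≤ (q : ℝ)})))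
    {u : Fin k → ℝ} (hu : ∀ j, u j ∈ Set.Ioo (0 : ℝ) 1) :
    Tendsto (fun N : ℕ => empiricalBetaCopula (fun i : Fin N => x i) u) atTop (𝓝 (C u)) := by
  have hu' : u ∈ Set.Icc (0 : Fin k → ℝ) 1 := ⟨fun j => (hu j).1.le, fun j => (hu j).2.le⟩
  have hCF : ∀ q : Fin k → ℚ, μ.real (Set.Iic fun j => (q j : ℝ)) =
      C fun j => marginalCDF μ j (q j) := fun q => hC.2 _
  simp only [← marginalCDF_eq_real] at hmarg
  simp only [hCF] at hjoint
  -- Dividing by `k + 1` keeps the case `k = 0` harmless.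
  have hsmall : ∀ ε > 0, ∃ η > 0, (k : ℝ) * η < ε := fun ε hε =>
    ⟨ε / (k + 1), by positivity, by
      rw [← mul_div_assoc, div_lt_iff₀ (by positivity)]
      nlinarith⟩
  refine tendsto_order.2 ⟨fun a ha => ?_, fun a ha => ?_⟩
  · obtain ⟨η, hη, hkη⟩ := hsmall (C u - a) (sub_pos.2 ha)
    choose q hq using fun j => exists_rat_marginalCDF_mem_Ioo hμ j
      (le_max_left 0 (u j - η)) (max_lt (hu j).1 (sub_lt_self _ hη)) (hu j).2.le
    set v : Fin k → ℝ := fun j => marginalCDF μ j (q j) with hv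
    have hvu : ∀ j, v j < u j := fun j => (hq j).2
    have hva : a < C v := by
      have h1 := hC.1.sub_le hu' (marginalCDF_mem_Icc (μ := μ) fun j => (q j : ℝ))
        fun j => (hvu j).le
      have h2 : ∑ j, (u j - v j) ≤ k * η := by
        calc _ ≤ ∑ _j : Fin k, η := Finset.sum_le_sum fun j _ => by
              linarith [(le_max_right 0 (u j - η)).trans_lt (hq j).1]
          _ = _ := by simp
      linarith
    -- The threshold is the midpoint of `v j` and `u j`: the marginal frequencies, tending to `v j`,
    -- eventually fall below it, and it keeps a fixed distance from `u j`.
    have hlim : Tendsto (fun N : ℕ => sampleFreq (fun i : Fin N => x i)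
        (Set.Iic fun j => (q j : ℝ)) *
          ∏ j, max 0 (1 - 1 / ((N : ℝ) * (u j - (v j + u j) / 2) ^ 2))) atTop (𝓝 (C v)) := by
      have : Tendsto (fun N : ℕ => ∏ j : Fin k,
          max 0 (1 - 1 / ((N : ℝ) * (u j - (v j + u j) / 2) ^ 2))) atTop
            (𝓝 (∏ _j : Fin k, max (0 : ℝ) (1 - 0))) :=
        tendsto_finsetProd _ fun j _ =>
          tendsto_const_nhds.max (tendsto_const_nhds.sub (tendsto_one_div_natCast_mul _))
      simpa using (hjoint q).mul this
    have hev : ∀ᶠ N : ℕ in atTop, ∀ j, sampleFreq (fun i : Fin N => x i)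
        {z | z j ≤ (q j : ℝ)} ≤ (v j + u j) / 2 :=
      eventually_all.2 fun j => ((hmarg j (q j)).eventually_lt_const
        (by linarith [hvu j] : v j < (v j + u j) / 2)).mono fun N h => h.le
    filter_upwards [hev, hlim.eventually_const_lt hva, eventually_gt_atTop 0] with N h1 h2 hN
    exact h2.trans_le (le_empiricalBetaCopula hN _ hu' (fun j => by linarith [hvu j]) h1)
  · obtain ⟨η, hη, hkη⟩ := hsmall (a - C u) (sub_pos.2 ha)
    choose q hq using fun j => exists_rat_marginalCDF_mem_Ioo hμ j
      (hu j).1.le (lt_min (hu j).2 (lt_add_of_pos_right (u j) hη)) (min_le_left 1 (u j + η))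
    set v : Fin k → ℝ := fun j => marginalCDF μ j (q j) with hv
    have huv : ∀ j, u j < v j := fun j => (hq j).1
    have hva : C v < a := by
      have h1 := hC.1.sub_le (marginalCDF_mem_Icc (μ := μ) fun j => (q j : ℝ)) hu'
        fun j => (huv j).le
      have h2 : ∑ j, (v j - u j) ≤ k * η := by
        calc _ ≤ ∑ _j : Fin k, η := Finset.sum_le_sum fun j _ => by
              linarith [(hq j).2.trans_le (min_le_right 1 (u j + η))]
          _ = _ := by simp
      linarith
    have hlim : Tendsto (fun N : ℕ => sampleFreq (fun i : Fin N => x i)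
        (Set.Iic fun j => (q j : ℝ)) +
          ∑ j, 1 / ((N : ℝ) * (u j - (v j + u j) / 2) ^ 2)) atTop (𝓝 (C v)) := by
      have : Tendsto (fun N : ℕ => ∑ j : Fin k,
          1 / ((N : ℝ) * (u j - (v j + u j) / 2) ^ 2)) atTop (𝓝 (∑ _j : Fin k, (0 : ℝ))) :=
        tendsto_finsetSum _ fun j _ => tendsto_one_div_natCast_mul _
      simpa only [Finset.sum_const_zero, add_zero] using (hjoint q).add this
    have hev : ∀ᶠ N : ℕ in atTop, ∀ j, (v j + u j) / 2 ≤ sampleFreq (fun i : Fin N => x i)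
        {z | z j ≤ (q j : ℝ)} :=
      eventually_all.2 fun j => ((hmarg j (q j)).eventually_const_lt
        (by linarith [huv j] : (v j + u j) / 2 < v j)).mono fun N h => h.le
    filter_upwards [hev, hlim.eventually_lt_const hva, eventually_gt_atTop 0] with N h1 h2 hN
    exact (empiricalBetaCopula_le hN _ hu' (fun j => by linarith [huv j]) h1).trans_lt h2

/-- Strong consistency of the empirical beta copula on the open unit cube. -/
theorem ae_tendsto_empiricalBetaCopula {Ω : Type*} [MeasurableSpace Ω] {P : Measure Ω}
    [IsProbabilityMeasure P] (hμ : IsContinuousLaw μ) (hC : IsCopulaOf C μ)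
    {X : ℕ → Ω → Fin k → ℝ} (hlaw : ∀ i, HasLaw (X i) μ P) (hindep : iIndepFun X P) :
    ∀ᵐ ω ∂P, ∀ u : Fin k → ℝ, (∀ j, u j ∈ Set.Ioo (0 : ℝ) 1) →
      Tendsto (fun N : ℕ => empiricalBetaCopula (fun i : Fin N => X i ω) u) atTop
        (𝓝 (C u)) := by
  -- Rational corners are countable, so one null set serves all `u`.
  have hjoint : ∀ᵐ ω ∂P, ∀ q : Fin k → ℚ, Tendsto (fun N : ℕ =>
      sampleFreq (fun i : Fin N => X i ω) (Set.Iic fun j => (q j : ℝ))) atTop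
        (𝓝 (μ.real (Set.Iic fun j => (q j : ℝ)))) := ae_all_iff.2 fun q =>
    ae_tendsto_sampleFreq hlaw hindep measurableSet_Iic
  have hmarg : ∀ᵐ ω ∂P, ∀ (j : Fin k) (q : ℚ), Tendsto (fun N : ℕ =>
      sampleFreq (fun i : Fin N => X i ω) {z | z j ≤ (q : ℝ)}) atTop
        (𝓝 (μ.real {z | z j ≤ (q : ℝ)})) := by
    refine ae_all_iff.2 fun j => ae_all_iff.2 fun q => ?_
    have hm : MeasurableSet {z : Fin k → ℝ | z j ≤ (q : ℝ)} :=
      measurableSet_le (measurable_pi_apply j) measurable_const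
    exact ae_tendsto_sampleFreq hlaw hindep hm
  filter_upwards [hjoint, hmarg] with ω h1 h2 u hu
  exact tendsto_empiricalBetaCopula (x := fun i => X i ω) hμ hC h1 h2 hu

end Pointwise

/-- Dominated convergence on the unit cube for continuous functionals of `[0,1]`-valued
functions. -/
theorem tendsto_setIntegral_comp_unitCube {k : ℕ} {g : ℝ → ℝ}
    (hg : ContinuousOn g (Set.Icc 0 1)) {f : ℕ → (Fin k → ℝ) → ℝ} {C : (Fin k → ℝ) → ℝ}
    (hf : ∀ N, Continuous (f N))
    (hf01 : ∀ N, ∀ u ∈ Set.Icc (0 : Fin k → ℝ) 1, f N u ∈ Set.Icc (0 : ℝ) 1)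
    (hC01 : ∀ u ∈ Set.Icc (0 : Fin k → ℝ) 1, C u ∈ Set.Icc (0 : ℝ) 1)
    (hlim : ∀ u : Fin k → ℝ, (∀ j, u j ∈ Set.Ioo (0 : ℝ) 1) →
      Tendsto (fun N => f N u) atTop (𝓝 (C u))) :
    Tendsto (fun N => ∫ u in Set.Icc (0 : Fin k → ℝ) 1, g (f N u)) atTop
      (𝓝 (∫ u in Set.Icc (0 : Fin k → ℝ) 1, g (C u))) := by
  obtain ⟨M, hM⟩ := isCompact_Icc.exists_bound_of_continuousOn hg
  have hfin : volume (Set.Icc (0 : Fin k → ℝ) 1) ≠ ⊤ := isCompact_Icc.measure_lt_top.ne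
  refine tendsto_integral_of_dominated_convergence (fun _ => M) (fun N => ?_) ?_ (fun N => ?_) ?_
  · exact (hg.comp (hf N).continuousOn (hf01 N)).aestronglyMeasurable measurableSet_Icc
  · exact integrableOn_const hfin
  · exact (ae_restrict_mem measurableSet_Icc).mono fun u hu => hM _ (hf01 N u hu)
  -- The boundary of the cube is null, so convergence at interior points suffices.
  · have hcube : (Set.univ.pi fun _ => Set.Ioo (0 : ℝ) 1) =ᵐ[volume]
        Set.Icc (0 : Fin k → ℝ) 1 :=
      Measure.univ_pi_Ioo_ae_eq_Icc (f := (0 : Fin k → ℝ)) (g := 1)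
    rw [← Measure.restrict_congr_set hcube]
    refine (ae_restrict_mem (MeasurableSet.univ_pi fun _ => measurableSet_Ioo)).mono
      fun u hu => ?_
    have hu' : ∀ j, u j ∈ Set.Ioo (0 : ℝ) 1 := fun j => hu j (Set.mem_univ j)
    have hmem : u ∈ Set.Icc (0 : Fin k → ℝ) 1 := ⟨fun j => (hu' j).1.le, fun j => (hu' j).2.le⟩
    exact (hg (C u) (hC01 u hmem)).tendsto.comp
      (tendsto_nhdsWithin_iff.2 ⟨hlim u hu', Eventually.of_forall fun N => hf01 N u hmem⟩)

/-- For `r > 0` the function equals `(r * negMulLog (x ^ (1/r))) ^ r` on `[0,1]`, which reduces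
continuity at 0 to that of `Real.negMulLog`. -/
theorem continuousOn_mul_neg_log_rpow {r : ℝ} (hr : 0 ≤ r) :
    ContinuousOn (fun x : ℝ => x * (-Real.log x) ^ r) (Set.Icc 0 1) := by
  rcases hr.eq_or_lt with rfl | hr
  · simp only [Real.rpow_zero, mul_one]
    exact continuousOn_id
  have hcont : Continuous fun x : ℝ => (r * Real.negMulLog (x ^ r⁻¹)) ^ r :=
    (Real.continuous_rpow_const hr.le).comp (continuous_const.mul
      (Real.continuous_negMulLog.comp (Real.continuous_rpow_const (inv_nonneg.2 hr.le))))
  refine hcont.continuousOn.congr fun x hx => ?_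
  rcases hx.1.eq_or_lt with rfl | hx0
  · simp [Real.zero_rpow (inv_ne_zero hr.ne'), Real.zero_rpow hr.ne']
  have hlog : 0 ≤ -Real.log x := neg_nonneg.2 (Real.log_nonpos hx.1 hx.2)
  have : r * Real.negMulLog (x ^ r⁻¹) = x ^ r⁻¹ * -Real.log x := by
    rw [Real.negMulLog, Real.log_rpow hx0]
    field_simp
  simp only [this]
  rw [Real.mul_rpow (Real.rpow_nonneg hx.1 _) hlog, Real.rpow_inv_rpow hx.1 hr.ne']

end

theorem mainTheorem2 {k : ℕ} {Ω : Type*} [MeasurableSpace Ω] (P : Measure Ω)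
    [IsProbabilityMeasure P] (μ : Measure (Fin k → ℝ)) [IsProbabilityMeasure μ]
    (hμ : IsContinuousLaw μ) (C : (Fin k → ℝ) → ℝ) (hC : IsCopulaOf C μ)
    (X : ℕ → Ω → Fin k → ℝ) (hlaw : ∀ i, HasLaw (X i) μ P) (hindep : iIndepFun X P) :
    (∀ r ∈ Set.Icc (0 : ℝ) 1, ∀ᵐ ω ∂P,
      Filter.Tendsto
        (fun N : ℕ => fracCCE r (empiricalBetaCopula (fun i : Fin N => X i ω)))
        Filter.atTop (nhds (fracCCE r C))) ∧
    (∀ s : ℝ, 0 < s → ∀ᵐ ω ∂P,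
      Filter.Tendsto
        (fun N : ℕ => CCIGF (empiricalBetaCopula (fun i : Fin N => X i ω)) s)
        Filter.atTop (nhds (CCIGF C s))) := by
  have hae := ae_tendsto_empiricalBetaCopula hμ hC hlaw hindep
  refine ⟨fun r hr => ?_, fun s hs => ?_⟩ <;> filter_upwards [hae] with ω hω
  · exact tendsto_setIntegral_comp_unitCube (continuousOn_mul_neg_log_rpow hr.1)
      (fun N => continuous_empiricalBetaCopula _) (fun N u hu => empiricalBetaCopula_mem_Icc _ hu)
      (fun u hu => hC.1.mem_Icc hu) hω
  · exact tendsto_setIntegral_comp_unitCube (g := fun x => x ^ s)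
      (Real.continuous_rpow_const hs.le).continuousOn
      (fun N => continuous_empiricalBetaCopula _) (fun N u hu => empiricalBetaCopula_mem_Icc _ hu)
      (fun u hu => hC.1.mem_Icc hu) hω
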